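/- Let $q$ be the $2$-uniform morphism on the alphabet $\{0,1,\ldots,21\}$ given by (commas separate letters) $$\begin{array}{llll} q(0)=0,1 & q(1)=2,3 & q(2)=4,5 & q(3)=6,7\\ q(4)=8,9 & q(5)=10,11 & q(6)=12,7 & q(7)=8,9\\ q(8)=13,14 & q(9)=15,1 & q(10)=2,16 & q(11)=7,17\\ q(12)=6,4 & q(13)=2,16 & q(14)=18,19 & q(15)=0,1\\ q(16)=6,7 & q(17)=10,11 & q(18)=20,9 & q(19)=10,21\\ q(20)=13,14 & q(21)=18,19 & & \end{array}$$ and let $\gamma:\{0,\ldots,21\}\to\{0,1\}$ be the coding with $\gamma(a)=1$ for $a\in\{0,1,3,6,7,11,12,13,14,17,19,20\}$ and $\gamma(a)=0$ for the other letters. Since $q(0)$ begins with $0$, the words $q^n(0)$ are prefixes of one infinite word $q^\omega(0)$, which is a fixed point of $q$. Then the infinite binary word $$\gamma(q^\omega(0)) = 11010011000111001101001110001101000111010011000\cdots$$ contains exactly three distinct squares (a square is a nonempty word of the form $uu$, and a word is contained in an infinite word if it occurs there as a block of consecutive letters), namely $0^2=00$, $1^2=11$ and $(10)^2=1010$. It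 is generated by a deterministic finite automaton with output that has $22$ states and reads the base-$2$ representation of $n$, most significant digit first: the states are the letters $0,\ldots,21$, the initial state is $0$, the digit $d\in\{0,1\}$ leads from $a$ to the letter of $q(a)$ with index $d$ (counting from $0$), and the output of $a$ is $\gamma(a)$. The weight of the word, that is, the weight $\sum_{a}|q(a)|$ of its defining morphism $q$, is $44$. -/

import Mathlib

namespace ThreeSquares

/-- A morphism from words over `α` to words over `β`; it is determined by the images of
the letters, and these may be prescribed freely. -/
abbrev Morphism (α β : Type*) := α → List β

/-- The action of a morphism on finite words: `h (a₁ ⋯ aₘ) = h a₁ ⋯ h aₘ`. -/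
def Morphism.apply {α β : Type*} (h : Morphism α β) (w : List α) : List β :=
  w.flatMap h

/-- A morphism is `k`-uniform if the image of every letter has length `k`. -/
def Morphism.IsUniform {α β : Type*} (h : Morphism α β) (k : ℕ) : Prop :=
  ∀ a, (h a).length = k

/-- The condition under which `h` can be iterated infinitely on the letter `a`:
`h a = a x` for some word `x` such that no `hⁱ x` is empty. -/
def Morphism.IsProlongable {α : Type*} (h : Morphism α α) (a : α) : Prop :=
  ∃ x : List α, h a = a :: x ∧ ∀ i : ℕ, h.apply^[i] x ≠ []

/-- The weight of a morphism: the sum of the lengths of the images of the letters. -/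
def Morphism.weight {α : Type*} [Fintype α] (h : Morphism α α) : ℕ :=
  ∑ a, (h a).length

/-- The infinite word `h^ω(a) = a x h(x) h²(x) ⋯`, where `h a = a x`. Its letter with index `n`
is that of `hⁿ(a) = a x h(x) ⋯ hⁿ⁻¹(x)`. If `h` is prolongable on `a`, then `hⁿ(a)` has at least
`n + 1` letters and is a prefix of `hⁿ⁺¹(a)`, so the default value is not used. -/
def Morphism.omega {α : Type*} (h : Morphism α α) (a : α) : ℕ → α :=
  fun n => (h.apply^[n] [a]).getD n a

/-- The word `x[i] x[i+1] ⋯ x[i+m-1]` inside an infinite word `x`. -/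
def subword {α : Type*} (x : ℕ → α) (i m : ℕ) : List α :=
  (List.range m).map fun t => x (i + t)

/-- The finite word `w` occurs in the infinite word `x` as a block of consecutive letters. -/
def IsFactor {α : Type*} (w : List α) (x : ℕ → α) : Prop :=
  ∃ i : ℕ, subword x i w.length = w

/-- The finite word `w` is a prefix of the infinite word `x`. -/
def IsPrefix {α : Type*} (w : List α) (x : ℕ → α) : Prop :=
  subword x 0 w.length = w

/-- The infinite word `x` satisfies `h(x) = x`: the image of every finite prefix of `x` is
again a prefix of `x`. -/
def Morphism.IsFixedPoint {α : Type*} (h : Morphism α α) (x : ℕ → α) : Prop :=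
  ∀ m : ℕ, IsPrefix (h.apply (subword x 0 m)) x

/-- A square is a nonempty word of the form `u u`. -/
def IsSquareWord {α : Type*} (w : List α) : Prop :=
  ∃ u : List α, u ≠ [] ∧ w = u ++ u

/-- The set of all (distinct) squares that occur in the infinite word `x`. -/
def squaresIn {α : Type*} (x : ℕ → α) : Set (List α) :=
  {w | IsSquareWord w ∧ IsFactor w x}

/-- A deterministic finite automaton with output, which reads base-`k` digits, has set of
states `S` and output alphabet `β`. -/
structure DFAO (k : ℕ) (S β : Type*) where
  /-- the transition function -/
  step : S → Fin k → S
  /-- the initial state -/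
  start : S
  /-- the output of a state -/
  out : S → β

/-- The number with base-`k` representation `w`, most significant digit first. -/
def msdValue {k : ℕ} (w : List (Fin k)) : ℕ :=
  Nat.ofDigits k (w.reverse.map Fin.val)

/-- The output of the automaton on the digit string `w`, read from left to right. -/
def DFAO.run {k : ℕ} {S β : Type*} (M : DFAO k S β) (w : List (Fin k)) : β :=
  M.out (w.foldl M.step M.start)

/-- The automaton generates `x`: on each base-`k` representation of `n`, most significant digit
first, with or without leading zeros, the output is `x n`. -/
def DFAO.Generates {k : ℕ} {S β : Type*} (M : DFAO k S β) (x : ℕ → β) : Prop :=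
  ∀ (n : ℕ) (w : List (Fin k)), msdValue w = n → M.run w = x n

/-- The morphism `q` on the alphabet `{0, 1, …, 21}`. -/
def q : Morphism (Fin 22) (Fin 22) :=
  ![[0, 1], [2, 3], [4, 5], [6, 7], [8, 9], [10, 11], [12, 7], [8, 9], [13, 14], [15, 1],
    [2, 16], [7, 17], [6, 4], [2, 16], [18, 19], [0, 1], [6, 7], [10, 11], [20, 9], [10, 21],
    [13, 14], [18, 19]]

/-- The coding `γ` from `{0, 1, …, 21}` to `{0, 1}`. -/
def γ : Fin 22 → Fin 2 :=
  ![1, 1, 0, 1, 0, 0, 1, 1, 0, 0, 0, 1, 1, 1, 1, 0, 0, 1, 0, 1, 1, 0]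

/-- The infinite binary word `γ(q^ω(0))`. -/
def word : ℕ → Fin 2 := fun n => γ (q.omega 0 n)

/-- The automaton of `q` and `γ`: its states are the letters `0, …, 21`, the initial state is
`0`, the digit `d` leads from `a` to the letter of `q a` with index `d`, and the output of `a`
is `γ a`. -/
def automaton : DFAO 2 (Fin 22) (Fin 2) where
  step a d := (q a).getD d.val 0
  start := 0
  out := γ

end ThreeSquares

/-! Every short block of `q^ω(0)` lies in some `q^k(ab)` with `ab` in `letterPairs`, so statements
about bounded blocks are finite checks. Long squares are excluded by descent. Letters are merged
into nine classes, on which `q` induces an injective morphism. In the class word, blocks of length 9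
determine the parity of their position, so a square of period above 8 has even period and
desubstitutes to one of half the period (`classWord_squarefree`). In the binary word, blocks of
length 19 determine the classes, so a square of period at least 19 would give a square of classes.
Periods up to 18 are checked (`windows_short_squares`). -/

namespace ThreeSquares

/-! ### Morphisms and blocks of infinite words -/

section Words

variable {α β : Type*}

theorem Morphism.apply_append (h : Morphism α β) (u v : List α) :
    h.apply (u ++ v) = h.apply u ++ h.apply v := by
  simp [Morphism.apply]

theorem Morphism.length_apply {h : Morphism α β} {k : ℕ} (hu : h.IsUniform k) (w : List α) :
    (h.apply w).length = k * w.length := by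
  induction w with
  | nil => simp [Morphism.apply]
  | cons a w ih =>
    have : h.apply (a :: w) = h a ++ h.apply w := by simp [Morphism.apply]
    rw [this, List.length_append, hu, ih, List.length_cons]
    ring

theorem Morphism.length_iterate_apply {h : Morphism α α} {k : ℕ} (hu : h.IsUniform k) (i : ℕ)
    (w : List α) : (h.apply^[i] w).length = k ^ i * w.length := by
  induction i with
  | zero => simp
  | succ i ih =>
    rw [Function.iterate_succ_apply', Morphism.length_apply hu, ih]
    ring

theorem subword_length (x : ℕ → α) (i m : ℕ) : (subword x i m).length = m := by
  simp [subword]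

theorem subword_getElem (x : ℕ → α) (i m t : ℕ) (ht : t < (subword x i m).length) :
    (subword x i m)[t] = x (i + t) := by
  simp [subword]

theorem subword_add (x : ℕ → α) (i m n : ℕ) :
    subword x i (m + n) = subword x i m ++ subword x (i + m) n := by
  simp [subword, List.range_add, Nat.add_assoc, Function.comp_def]

theorem take_drop_subword (x : ℕ → α) {i o m n : ℕ} (h : o + n ≤ m) :
    ((subword x i m).drop o).take n = subword x (i + o) n := by
  apply List.ext_getElem
  · simp [subword]; omega
  · intro t h1 h2
    simp [subword, Nat.add_assoc]

theorem map_subword (f : α → β) (x : ℕ → α) (i m : ℕ) :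
    (subword x i m).map f = subword (fun n => f (x n)) i m := by
  simp [subword]

theorem subword_eq_iff {x : ℕ → α} {i j m : ℕ} :
    subword x i m = subword x j m ↔ ∀ t < m, x (i + t) = x (j + t) := by
  simp [subword]

/-- A word `u u` occurs at position `i` with `|u| = m` iff `m` consecutive letters agree with
those `m` places further on. -/
theorem subword_isSquare_iff {x : ℕ → α} {i : ℕ} {w : List α} (hw : subword x i w.length = w) :
    IsSquareWord w ↔
      ∃ m, 0 < m ∧ w.length = m + m ∧ ∀ t < m, x (i + t) = x (i + m + t) := by
  constructor
  · rintro ⟨u, hu, rfl⟩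
    refine ⟨u.length, List.length_pos_of_ne_nil hu, by simp, ?_⟩
    rw [List.length_append, subword_add] at hw
    have h := List.append_inj hw (subword_length ..)
    exact subword_eq_iff.1 (h.1.trans h.2.symm)
  · rintro ⟨m, hm, hl, h⟩
    refine ⟨subword x i m, ?_, ?_⟩
    · intro h0
      have := subword_length x i m
      rw [h0] at this
      simp at this
      omega
    · rw [← hw, hl, subword_add, ← subword_eq_iff.2 h]

end Words

/-! ### The fixed point of `q` -/

section Omega

theorem q_isUniform : q.IsUniform 2 := by
  unfold Morphism.IsUniform
  decide

theorem q_isProlongable : q.IsProlongable 0 := by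
  refine ⟨[1], rfl, fun i h => ?_⟩
  have := Morphism.length_iterate_apply q_isUniform i [1]
  rw [h] at this
  have hpos : 0 < 2 ^ i := by positivity
  simp at this
  omega

theorem iterate_q_zero_prefix_succ (n : ℕ) : q.apply^[n] [0] <+: q.apply^[n + 1] [0] := by
  induction n with
  | zero => exact ⟨[1], rfl⟩
  | succ n ih =>
    obtain ⟨v, hv⟩ := ih
    rw [Function.iterate_succ_apply' _ n, Function.iterate_succ_apply' _ (n + 1), ← hv,
      Morphism.apply_append]
    exact List.prefix_append _ _

theorem iterate_q_zero_prefix {m n : ℕ} (h : m ≤ n) : q.apply^[m] [0] <+: q.apply^[n] [0] := by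
  induction n, h using Nat.le_induction with
  | base => exact List.prefix_rfl
  | succ n _ ih => exact ih.trans (iterate_q_zero_prefix_succ n)

theorem length_iterate_q_zero (n : ℕ) : (q.apply^[n] [0]).length = 2 ^ n := by
  simpa using Morphism.length_iterate_apply q_isUniform n [0]

theorem getElem_iterate_q_zero (k n : ℕ) (h : n < (q.apply^[k] [0]).length) :
    (q.apply^[k] [0])[n] = q.omega 0 n := by
  have hn : n < (q.apply^[n] [0]).length := by
    rw [length_iterate_q_zero]; exact Nat.lt_two_pow_self
  rw [Morphism.omega, List.getD_eq_getElem _ _ hn]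
  rcases le_total k n with hkn | hkn
  · exact (iterate_q_zero_prefix hkn).getElem h
  · exact ((iterate_q_zero_prefix hkn).getElem hn).symm

theorem iterate_q_zero (k : ℕ) : q.apply^[k] [0] = subword (q.omega 0) 0 (2 ^ k) := by
  apply List.ext_getElem
  · rw [length_iterate_q_zero, subword_length]
  · intro t h1 h2
    rw [getElem_iterate_q_zero, subword_getElem, zero_add]

theorem q_apply_prefix (m : ℕ) :
    q.apply (subword (q.omega 0) 0 m) = subword (q.omega 0) 0 (2 * m) := by
  have hm : m ≤ 2 ^ m := Nat.lt_two_pow_self.le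
  have h := iterate_q_zero (m + 1)
  rw [Function.iterate_succ_apply', iterate_q_zero, show 2 ^ m = m + (2 ^ m - m) by omega,
    subword_add, Morphism.apply_append,
    show 2 ^ (m + 1) = 2 * m + (2 ^ (m + 1) - 2 * m) by rw [pow_succ]; omega, subword_add] at h
  refine (List.append_inj h ?_).1
  rw [Morphism.length_apply q_isUniform, subword_length, subword_length]

theorem q_apply_subword (a m : ℕ) :
    q.apply (subword (q.omega 0) a m) = subword (q.omega 0) (2 * a) (2 * m) := by
  have h := q_apply_prefix (a + m)
  rw [subword_add, Morphism.apply_append, q_apply_prefix, mul_add, subword_add] at h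
  simpa using h

theorem iterate_q_subword (k a m : ℕ) :
    q.apply^[k] (subword (q.omega 0) a m) = subword (q.omega 0) (2 ^ k * a) (2 ^ k * m) := by
  induction k with
  | zero => simp
  | succ k ih =>
    rw [Function.iterate_succ_apply', ih, q_apply_subword]
    congr 1 <;> ring

theorem q_omega (n : ℕ) : q (q.omega 0 n) = [q.omega 0 (2 * n), q.omega 0 (2 * n + 1)] := by
  simpa [subword, Morphism.apply, List.range_succ] using q_apply_subword n 1

end Omega

/-! ### Finite lists containing all short factors -/

section Factors

/-- The words of length two that occur in `q^ω(0)`. -/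
def letterPairs : List (Fin 22 × Fin 22) :=
  [(0, 1), (1, 2), (2, 3), (2, 16), (3, 4), (4, 5), (4, 8), (5, 6), (6, 4), (6, 7), (7, 8),
    (7, 17), (7, 20), (8, 9), (9, 10), (9, 13), (10, 11), (10, 21), (11, 12), (12, 7), (13, 14),
    (14, 15), (15, 1), (16, 7), (16, 18), (17, 6), (18, 19), (19, 0), (20, 9), (21, 0)]

/-- Each pair in the fixed point starts at the first or second letter of some `q a`, so the pair
inside `q b` is not needed. -/
theorem letterPairs_closed : ∀ p ∈ letterPairs,
    ((q p.1).getD 0 0, (q p.1).getD 1 0) ∈ letterPairs ∧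
      ((q p.1).getD 1 0, (q p.2).getD 0 0) ∈ letterPairs := by
  decide +kernel

theorem omega_pair_mem (n : ℕ) : (q.omega 0 n, q.omega 0 (n + 1)) ∈ letterPairs := by
  induction n using Nat.strong_induction_on with
  | _ n ih =>
    rcases Nat.eq_zero_or_pos n with rfl | hn
    · have h := q_omega 0
      have h0 : q.omega 0 0 = 0 := rfl
      simp only [mul_zero, zero_add, h0] at h ⊢
      have h1 : q.omega 0 1 = 1 := by
        have : q 0 = [0, 1] := rfl
        rw [this] at h
        simpa using h.symm
      rw [h1]
      decide
    · have hc := letterPairs_closed _ (ih (n / 2) (by omega))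
      simp only [q_omega, List.getD_cons_zero, List.getD_cons_succ] at hc
      rcases Nat.mod_two_eq_zero_or_one n with h | h
      · rw [show 2 * (n / 2) = n by omega] at hc
        exact hc.1
      · rw [show 2 * (n / 2) + 1 = n by omega, show 2 * (n / 2 + 1) = n + 1 by omega] at hc
        exact hc.2

/-- Every property of a position that depends only on the block of length `L` found there can be
checked on the images under `qᵏ` of the words of length two. -/
theorem exists_window (k i : ℕ) : ∃ p ∈ letterPairs, ∃ o < 2 ^ k, i % 2 ^ k = o ∧
    ∀ L ≤ 2 ^ k + 1, subword (q.omega 0) i L = ((q.apply^[k] [p.1, p.2]).drop o).take L := by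
  have hpos : 0 < 2 ^ k := by positivity
  have hlt := Nat.mod_lt i hpos
  refine ⟨_, omega_pair_mem (i / 2 ^ k), i % 2 ^ k, hlt, rfl, fun L hL => ?_⟩
  have h : [q.omega 0 (i / 2 ^ k), q.omega 0 (i / 2 ^ k + 1)]
      = subword (q.omega 0) (i / 2 ^ k) 2 := by
    simp [subword, List.range_succ]
  simp only [h]
  -- The offset is at most `2 ^ k - 1`, so a block of length at most `2 ^ k + 1` ends within the `2
  -- * 2 ^ k` letters.
  rw [iterate_q_subword, take_drop_subword _ (by omega), Nat.div_add_mod]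

/-- All blocks of length `L` in the images under `qᵏ` of the words of length two, with their
positions in these images. -/
def windows (k L : ℕ) : List (List (Fin 22) × ℕ) :=
  letterPairs.flatMap fun p =>
    let w := q.apply^[k] [p.1, p.2]
    (List.range (2 ^ k)).map fun o => ((w.drop o).take L, o)

theorem mem_windows {k L : ℕ} (hL : L ≤ 2 ^ k + 1) (i : ℕ) :
    (subword (q.omega 0) i L, i % 2 ^ k) ∈ windows k L := by
  obtain ⟨p, hp, o, ho, hio, h⟩ := exists_window k i
  rw [h L hL, hio]
  simp only [windows, List.mem_flatMap, List.mem_map, List.mem_range]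
  exact ⟨p, hp, o, ho, rfl⟩

end Factors

/-! ### Squarefreeness of the class word -/

section Reduction

/-- The coarsest identification of the letters under which `q` induces a morphism that is
injective on letters. -/
def letterClass : Fin 22 → Fin 9 :=
  ![0, 1, 2, 3, 4, 5, 6, 4, 7, 0, 1, 2, 3, 1, 8, 0, 3, 5, 4, 7, 7, 8]

/-- The morphism induced by `q` on the classes of letters. -/
def classMorphism : Fin 9 → Fin 9 × Fin 9 :=
  ![(0, 1), (2, 3), (4, 5), (6, 4), (7, 0), (1, 2), (3, 4), (1, 8), (4, 7)]

/-- The word `q^ω(0)` with letters identified according to their class. -/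
def classWord (n : ℕ) : Fin 9 := letterClass (q.omega 0 n)

theorem classMorphism_letterClass : ∀ a : Fin 22, (q a).map letterClass =
    [(classMorphism (letterClass a)).1, (classMorphism (letterClass a)).2] := by
  decide

theorem classMorphism_classWord (n : ℕ) :
    classMorphism (classWord n) = (classWord (2 * n), classWord (2 * n + 1)) := by
  have h := classMorphism_letterClass (q.omega 0 n)
  rw [q_omega] at h
  simp only [List.map_cons, List.map_nil, List.cons.injEq, and_true] at h
  exact Prod.ext h.1.symm h.2.symm

theorem classMorphism_injective : Function.Injective classMorphism := by
  unfold Function.Injective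
  decide

/-- Images share a second letter only for classes 3 and 6, and a first letter only for 2, 8 and for
5, 7; `b` cannot belong to both kinds of collision. -/
theorem eq_or_eq_of_classMorphism : ∀ a b c : Fin 9,
    (classMorphism a).2 = (classMorphism b).2 → (classMorphism b).1 = (classMorphism c).1 →
      a = b ∨ b = c := by
  decide

/-- Blocks of nine letters of the class word, with the parity of their position. -/
def parityWindows : List (List (Fin 9) × ℕ) :=
  ((windows 4 9).map fun p => (p.1.map letterClass, p.2 % 2)).dedup

theorem parityWindows_synchronized : ∀ u ∈ parityWindows, ∀ v ∈ parityWindows,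
    u.1 = v.1 → u.2 = v.2 := by
  decide +kernel

theorem mem_parityWindows (i : ℕ) : (subword classWord i 9, i % 2) ∈ parityWindows := by
  rw [parityWindows, List.mem_dedup, List.mem_map]
  refine ⟨_, mem_windows (k := 4) (by norm_num) i, ?_⟩
  simp only [map_subword, Prod.mk.injEq]
  exact ⟨rfl, by omega⟩

theorem classWord_parity {i j : ℕ} (h : ∀ t < 9, classWord (i + t) = classWord (j + t)) :
    i % 2 = j % 2 :=
  parityWindows_synchronized _ (mem_parityWindows i) _ (mem_parityWindows j)
    (subword_eq_iff.2 h)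

theorem windows_no_short_class_square : ∀ p ∈ windows 4 16, ∀ m ∈ List.range 8,
    (p.1.take (m + 1)).map letterClass ≠ ((p.1.drop (m + 1)).take (m + 1)).map letterClass := by
  decide +kernel

theorem classWord_no_short_square {m : ℕ} (hm : 0 < m) (hm' : m ≤ 8) (i : ℕ) :
    ¬ ∀ t < m, classWord (i + t) = classWord (i + m + t) := by
  intro h
  refine windows_no_short_class_square _ (mem_windows (by norm_num) i) (m - 1)
    (List.mem_range.2 (by omega)) ?_
  have h0 := take_drop_subword (q.omega 0) (i := i) (o := 0) (n := m) (m := 16) (by omega)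
  rw [List.drop_zero, add_zero] at h0
  rw [show m - 1 + 1 = m by omega, take_drop_subword _ (by omega), h0, map_subword, map_subword]
  exact subword_eq_iff.2 h

/-- The class word is squarefree. -/
theorem classWord_squarefree {m : ℕ} (hm : 0 < m) (i : ℕ) :
    ¬ ∀ t < m, classWord (i + t) = classWord (i + m + t) := by
  induction m using Nat.strong_induction_on generalizing i with
  | _ m ih =>
    intro h
    rcases le_or_gt m 8 with h8 | h8
    · exact classWord_no_short_square hm h8 i h
    have heven : m % 2 = 0 := by
      have := classWord_parity (i := i) (j := i + m) fun t ht => h t (by omega)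
      omega
    obtain ⟨n, rfl⟩ : ∃ n, m = 2 * n := ⟨m / 2, by omega⟩
    have h' : ∀ j, i ≤ j → j < i + 2 * n → classWord j = classWord (j + 2 * n) := by
      intro j h1 h2
      have := h (j - i) (by omega)
      rwa [show i + (j - i) = j by omega, show i + 2 * n + (j - i) = j + 2 * n by omega] at this
    have hblock : ∀ k, i ≤ 2 * k → 2 * k + 1 < i + 2 * n → classWord k = classWord (k + n) := by
      intro k h1 h2
      apply classMorphism_injective
      rw [classMorphism_classWord, classMorphism_classWord, h' _ h1 (by omega),
        h' (2 * k + 1) (by omega) h2]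
      congr 2 <;> ring
    rcases Nat.even_or_odd' i with ⟨k, rfl | rfl⟩
    · refine ih n (by omega) (by omega) k fun t ht => ?_
      rw [hblock (k + t) (by omega) (by omega)]
      congr 1; ring
    -- For odd `i` the square cuts the images of letters `k`, `k + n` and `k + 2n`. Comparing the
    -- visible halves extends the half-length square by one letter on the left or on the right.
    · have hends : classWord k = classWord (k + n) ∨
          classWord (k + n) = classWord (k + n + n) := by
        apply eq_or_eq_of_classMorphism
        · rw [classMorphism_classWord, classMorphism_classWord]
          exact (h' (2 * k + 1) (by omega) (by omega)).trans (congrArg classWord (by ring))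
        · rw [classMorphism_classWord, classMorphism_classWord]
          refine (congrArg classWord (by ring)).trans
            ((h' (2 * (k + n)) (by omega) (by omega)).trans (congrArg classWord (by ring)))
      rcases hends with he | he
      · refine ih n (by omega) (by omega) k fun t ht => ?_
        rcases Nat.eq_zero_or_pos t with rfl | ht0
        · simpa using he
        · rw [hblock (k + t) (by omega) (by omega)]
          congr 1; ring
      · refine ih n (by omega) (by omega) (k + 1) fun t ht => ?_
        rcases Nat.lt_or_ge (t + 1) n with ht1 | ht1
        · rw [hblock (k + 1 + t) (by omega) (by omega)]
          congr 1; ring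
        · rw [show k + 1 + t = k + n by omega, show k + 1 + n + t = k + n + n by omega]
          exact he

end Reduction

/-! ### Squares in the binary word -/

section Squares

/-- Blocks of nineteen letters of `γ(q^ω(0))`, with the classes of the letters coded by them. -/
def codedWindows : List (List (Fin 2) × List (Fin 9)) :=
  ((windows 5 19).map fun p => (p.1.map γ, p.1.map letterClass)).dedup

theorem codedWindows_synchronized : ∀ u ∈ codedWindows, ∀ v ∈ codedWindows,
    u.1 = v.1 → u.2 = v.2 := by
  decide +kernel

theorem mem_codedWindows (i : ℕ) :
    (subword word i 19, subword classWord i 19) ∈ codedWindows := by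
  rw [codedWindows, List.mem_dedup, List.mem_map]
  refine ⟨_, mem_windows (k := 5) (by norm_num) i, ?_⟩
  simp only [map_subword]
  rfl

theorem classWord_eq_of_word_eq {i j : ℕ} (h : ∀ t < 19, word (i + t) = word (j + t)) :
    ∀ t < 19, classWord (i + t) = classWord (j + t) :=
  subword_eq_iff.1 (codedWindows_synchronized _ (mem_codedWindows i) _ (mem_codedWindows j)
    (subword_eq_iff.2 h))

theorem word_no_long_square {m : ℕ} (hm : 19 ≤ m) (i : ℕ) :
    ¬ ∀ t < m, word (i + t) = word (i + m + t) := by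
  intro h
  refine classWord_squarefree (m := m) (by omega) i fun t ht => ?_
  have hs : ∀ s, s + 19 ≤ m → ∀ t < 19, classWord (i + s + t) = classWord (i + m + s + t) :=
    fun s hs => classWord_eq_of_word_eq fun r hr => by
      simpa only [add_assoc] using h (s + r) (by omega)
  rcases lt_or_ge t 19 with ht' | ht'
  · simpa using hs 0 (by omega) t ht'
  -- The window of length 19 whose last position is `t` stays inside the first half of the square.
  · have := hs (t - 18) (by omega) 18 (by norm_num)
    rwa [show i + (t - 18) + 18 = i + t by omega,
      show i + m + (t - 18) + 18 = i + m + t by omega] at this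

theorem windows_short_squares : ∀ p ∈ windows 6 36, ∀ m ∈ List.range 18,
    (p.1.take (m + 1)).map γ = ((p.1.drop (m + 1)).take (m + 1)).map γ →
      (p.1.take (m + 1)).map γ ∈ [[0], [1], [(1 : Fin 2), 0]] := by
  decide +kernel

theorem word_short_square {m : ℕ} (hm : 0 < m) (hm' : m ≤ 18) {i : ℕ}
    (h : ∀ t < m, word (i + t) = word (i + m + t)) :
    subword word i m ∈ [[0], [1], [(1 : Fin 2), 0]] := by
  have hw := windows_short_squares _ (mem_windows (by norm_num) i) (m - 1)
    (List.mem_range.2 (by omega))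
  have h0 := take_drop_subword (q.omega 0) (i := i) (o := 0) (n := m) (m := 36) (by omega)
  rw [List.drop_zero, add_zero] at h0
  rw [show m - 1 + 1 = m by omega, take_drop_subword _ (by omega), h0, map_subword,
    map_subword] at hw
  exact hw (subword_eq_iff.2 h)

theorem word_prefix : subword word 0 47 =
    [1, 1, 0, 1, 0, 0, 1, 1] ++ [0, 0, 0, 1, 1, 1, 0, 0] ++ [1, 1, 0, 1, 0, 0, 1, 1] ++
      [1, 0, 0, 0, 1, 1, 0, 1] ++ [0, 0, 0, 1, 1, 1, 0, 1] ++ [0, 0, 1, 1, 0, 0, 0] := by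
  -- `q^6(0)` has 64 letters, enough for a prefix of 47.
  have h := take_drop_subword (q.omega 0) (i := 0) (o := 0) (n := 47) (m := 2 ^ 6) (by norm_num)
  rw [← iterate_q_zero, List.drop_zero, add_zero] at h
  have h' := map_subword γ (q.omega 0) 0 47
  rw [← h] at h'
  refine Eq.trans h'.symm ?_
  decide +kernel

theorem isFactor_of_prefix {i m : ℕ} {w : List (Fin 2)} (hl : w.length = m) (him : i + m ≤ 47)
    (hw : ((subword word 0 47).drop i).take m = w) : IsFactor w word := by
  refine ⟨i, ?_⟩
  rw [take_drop_subword _ him, zero_add] at hw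
  rw [hl, hw]

theorem squaresIn_word : squaresIn word = {[0, 0], [1, 1], [1, 0, 1, 0]} := by
  ext w
  simp only [squaresIn, Set.mem_ofPred_eq, Set.mem_insert_iff, Set.mem_singleton_iff]
  constructor
  · rintro ⟨hsq, i, hi⟩
    obtain ⟨m, hm, hl, h⟩ := (subword_isSquare_iff hi).1 hsq
    have hm' : m ≤ 18 := by
      by_contra hc
      exact word_no_long_square (by omega) i h
    have hs := word_short_square hm hm' h
    rw [← hi, hl, subword_add, ← subword_eq_iff.2 h]
    simp only [List.mem_cons, List.not_mem_nil, or_false] at hs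
    rcases hs with hs | hs | hs <;> simp [hs]
  · rintro (rfl | rfl | rfl)
    · exact ⟨⟨[0], by simp, rfl⟩,
        isFactor_of_prefix (i := 4) (m := 2) rfl (by norm_num) (by rw [word_prefix]; rfl)⟩
    · exact ⟨⟨[1], by simp, rfl⟩,
        isFactor_of_prefix (i := 0) (m := 2) rfl (by norm_num) (by rw [word_prefix]; rfl)⟩
    · exact ⟨⟨[1, 0], by simp, rfl⟩,
        isFactor_of_prefix (i := 1) (m := 4) rfl (by norm_num) (by rw [word_prefix]; rfl)⟩

theorem ncard_squaresIn_word : (squaresIn word).ncard = 3 := by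
  rw [squaresIn_word, Set.ncard_eq_three]
  exact ⟨_, _, _, by decide, by decide, by decide, rfl⟩

end Squares

/-! ### The generating automaton -/

section Automaton

theorem msdValue_append_singleton {k : ℕ} (w : List (Fin k)) (d : Fin k) :
    msdValue (w ++ [d]) = k * msdValue w + d := by
  simp [msdValue, Nat.ofDigits_cons, add_comm]

/-- Appending the digit `d` sends `n` to `2n + d`, and by `q_omega` the letter at that index is the
one with index `d` in the image of letter `n`. Leading zeros keep the state at 0. -/
theorem automaton_foldl (w : List (Fin 2)) :
    w.foldl automaton.step automaton.start = q.omega 0 (msdValue w) := by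
  induction w using List.reverseRecOn with
  | nil => rfl
  | append_singleton w d ih =>
    rw [List.foldl_append, ih, msdValue_append_singleton]
    simp only [List.foldl_cons, List.foldl_nil, automaton, q_omega]
    fin_cases d <;> rfl

theorem automaton_generates : automaton.Generates word := by
  rintro n w rfl
  rw [DFAO.run, automaton_foldl]
  rfl

end Automaton

end ThreeSquares

theorem theorem6 :
    -- `q` is a 2-uniform morphism that can be iterated on `0`, and `q^ω(0)` is the word obtained
    -- in this way, a fixed point of `q`
    ThreeSquares.q.IsUniform 2 ∧
    ThreeSquares.q.IsProlongable 0 ∧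
    (∀ n : ℕ, ThreeSquares.IsPrefix (ThreeSquares.q.apply^[n] [0]) (ThreeSquares.q.omega 0)) ∧
    ThreeSquares.q.IsFixedPoint (ThreeSquares.q.omega 0) ∧
    -- `γ(q^ω(0)) = 11010011000111001101001110001101000111010011000⋯`
    ThreeSquares.IsPrefix
      ([1, 1, 0, 1, 0, 0, 1, 1] ++ [0, 0, 0, 1, 1, 1, 0, 0] ++ [1, 1, 0, 1, 0, 0, 1, 1] ++
        [1, 0, 0, 0, 1, 1, 0, 1] ++ [0, 0, 0, 1, 1, 1, 0, 1] ++ [0, 0, 1, 1, 0, 0, 0])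
      ThreeSquares.word ∧
    -- the squares that occur in it are exactly `0²`, `1²` and `(10)²`, three in number
    ThreeSquares.squaresIn ThreeSquares.word = {[0, 0], [1, 1], [1, 0, 1, 0]} ∧
    (ThreeSquares.squaresIn ThreeSquares.word).ncard = 3 ∧
    -- it is generated by the automaton of `q` and `γ`, which has 22 states
    ThreeSquares.automaton.Generates ThreeSquares.word ∧
    -- its weight, which is the weight of its defining morphism `q`, is 44
    ThreeSquares.q.weight = 44 := by
  refine ⟨ThreeSquares.q_isUniform, ThreeSquares.q_isProlongable, fun n => ?_, fun m => ?_,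
    ThreeSquares.word_prefix, ThreeSquares.squaresIn_word, ThreeSquares.ncard_squaresIn_word,
    ThreeSquares.automaton_generates, by decide⟩
  · rw [ThreeSquares.IsPrefix, ThreeSquares.length_iterate_q_zero, ThreeSquares.iterate_q_zero]
  · rw [ThreeSquares.IsPrefix, ThreeSquares.q_apply_prefix, ThreeSquares.subword_length]
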